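/- Let $M$ be a smooth, Hausdorff, finite-dimensional manifold (without boundary) and let $\boldsymbol\eta=\sum_{\mu=1}^k\eta^\mu\otimes e_\mu\in\Omega^1(M,\mathbb R^k)$ be a $k$-contact form on $M$: $\ker\boldsymbol\eta$ is a nonzero distribution of constant corank $k$, $\ker\mathrm d\boldsymbol\eta$ is a distribution of constant rank $k$, and $\ker\boldsymbol\eta\cap\ker\mathrm d\boldsymbol\eta=0$. Let $R_1,\dots,R_k$ be its Reeb vector fields, i.e. the unique ones with $\iota_{R_\mu}\eta^\nu=\delta_\mu^\nu$ and $\iota_{R_\mu}\mathrm d\eta^\nu=0$. A smooth vector field $Y$ on $M$ is called $\boldsymbol\eta$-Hamiltonian if it is a Lie symmetry of $\ker\boldsymbol\eta$ (i.e. $[Y,Z]$ takes values in $\ker\boldsymbol\eta$ for every smooth, possibly only locally defined, vector field $Z$ with values in $\ker\boldsymbol\eta$); its $\boldsymbol\eta$-Hamiltonian $k$-function is $\boldsymbol h=-\iota_Y\boldsymbol\eta\colon M\to\mathbb R^k$, and the Reeb derivation of $\boldsymbol h=(h^1,\dots,h^k)$ is the vector field $R_{\boldsymbol h}=\sum_{\mu=1}^k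 h^\mu R_\mu$. The bracket of the $\boldsymbol\eta$-Hamiltonian $k$-functions $\boldsymbol h,\boldsymbol h'$ of $Y,Y'$ is $\{\boldsymbol h,\boldsymbol h'\}_{\boldsymbol\eta}=\boldsymbol\eta([Y,Y'])$. Let $X$ be a $k$-contact Lie system on $M$ with an $r$-dimensional Vessiot--Guldberg Lie algebra of $\boldsymbol\eta$-Hamiltonian vector fields: $X(t,x)=\sum_{\alpha=1}^r b_\alpha(t)X_\alpha(x)$, where $b_1,\dots,b_r\colon\mathbb R\to\mathbb R$ are continuous and $X_1,\dots,X_r$ are $\boldsymbol\eta$-Hamiltonian vector fields forming a basis of an $r$-dimensional real Lie algebra of vector fields. Let $\boldsymbol h_1,\dots,\boldsymbol h_r$ be the $\boldsymbol\eta$-Hamiltonian $k$-functions of $X_1,\dots,X_r$, and let $\mathfrak W=\langle\boldsymbol h_1,\dots,\boldsymbol h_r\rangle$, with the bracket $\{\cdot,\cdot\}_{\boldsymbol\eta}$, be isomorphic to an abstract $r$-dimensional real Lie algebra $\mathfrak g$. Let $\{v^1,\dots,v^r\}$ be a basis of $\mathfrak g^*$ and define the momentum map $$\boldsymbol J\colon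 M\to\mathfrak g^*\otimes\mathbb R^k,\qquad \boldsymbol J(x)=\sum_{\alpha=1}^r v^\alpha\otimes\boldsymbol h_\alpha(x).$$ Let $\theta\in(\mathbb R^k)^*$, let $J^\theta=\langle\boldsymbol J,\theta\rangle\colon M\to\mathfrak g^*$, and let $S=(J^\theta)^{-1}(0)$. Assume that $S$ is an embedded submanifold of $M$ with $\mathrm T_xS=\ker\mathrm T_xJ^\theta$ for every $x\in S$ (i.e. $0$ is a weakly regular value of $J^\theta$), and that the Reeb derivations $R_{\boldsymbol h_1},\dots,R_{\boldsymbol h_r}$ are tangent to $S$ at all points of $S$. Then $S$ is invariant under the dynamics of $X$: every solution $\gamma$ of $\dot x=X(t,x)$ defined on an interval, with $\gamma(t_0)\in S$ for some $t_0$ in that interval, satisfies $\gamma(t)\in S$ for all $t$ in that interval. -/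

import Mathlib

open scoped Manifold ContDiff TensorProduct Topology

namespace KContact

noncomputable section

section Geometry

variable {E : Type*} [NormedAddCommGroup E] [NormedSpace ℝ E]
  {M : Type*} [TopologicalSpace M] [ChartedSpace E M]
  {F : Type*} [NormedAddCommGroup F] [NormedSpace ℝ F]

/-- Vector fields (not necessarily smooth) on the boundaryless manifold `M` modelled on `E`. -/
abbrev VField (E : Type*) [NormedAddCommGroup E] [NormedSpace ℝ E]
    (M : Type*) [TopologicalSpace M] [ChartedSpace E M] : Type _ :=
  (x : M) → TangentSpace 𝓘(ℝ, E) x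

/-- One-forms (not necessarily smooth) on `M` with values in `F`. -/
abbrev OneForm (E : Type*) [NormedAddCommGroup E] [NormedSpace ℝ E]
    (M : Type*) [TopologicalSpace M] [ChartedSpace E M]
    (F : Type*) [NormedAddCommGroup F] [NormedSpace ℝ F] : Type _ :=
  (x : M) → TangentSpace 𝓘(ℝ, E) x →L[ℝ] F

/-- The vector field `X` is smooth on the set `U`. -/
def SmoothVFieldOn [IsManifold 𝓘(ℝ, E) ∞ M] (X : VField E M) (U : Set M) : Prop :=
  ContMDiffOn 𝓘(ℝ, E) 𝓘(ℝ, E).tangent ∞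
    (fun x ↦ (⟨x, X x⟩ : TangentBundle 𝓘(ℝ, E) M)) U

/-- The vector field `X` is smooth. -/
def SmoothVField [IsManifold 𝓘(ℝ, E) ∞ M] (X : VField E M) : Prop :=
  ContMDiff 𝓘(ℝ, E) 𝓘(ℝ, E).tangent ∞
    (fun x ↦ (⟨x, X x⟩ : TangentBundle 𝓘(ℝ, E) M))

/-- The one-form `η` is smooth, as a section of `Hom(TM, M × F)`. -/
def SmoothOneForm [IsManifold 𝓘(ℝ, E) ∞ M] (η : OneForm E M F) : Prop :=
  haveI : IsManifold 𝓘(ℝ, E) 1 M := IsManifold.of_le (n := ∞) (by norm_cast)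
  ContMDiff 𝓘(ℝ, E) (𝓘(ℝ, E).prod 𝓘(ℝ, E →L[ℝ] F)) ∞
    (fun x ↦ Bundle.TotalSpace.mk' (E →L[ℝ] F)
      (E := fun y : M ↦ (TangentSpace 𝓘(ℝ, E) y →L[ℝ] Bundle.Trivial M F y)) x (η x))

/-- The expression of the one-form `η` in the preferred chart at `x₀`, i.e. its pullback
by the inverse of the chart. -/
def chartRep (η : OneForm E M F) (x₀ : M) (u : E) : E →L[ℝ] F :=
  (η ((extChartAt 𝓘(ℝ, E) x₀).symm u)).comp
    (mfderiv 𝓘(ℝ, E) 𝓘(ℝ, E) (extChartAt 𝓘(ℝ, E) x₀).symm u)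

/-- The exterior derivative of a one-form at `x`, as a bilinear map: in the chart at `x` it is
`dη(v, w) = (D_v η)(w) - (D_w η)(v)`. -/
def extD (η : OneForm E M F) (x : M) :
    TangentSpace 𝓘(ℝ, E) x →L[ℝ] TangentSpace 𝓘(ℝ, E) x →L[ℝ] F :=
  let D : E →L[ℝ] E →L[ℝ] F := fderiv ℝ (chartRep η x) (extChartAt 𝓘(ℝ, E) x x)
  let L : E →L[ℝ] E := mfderiv 𝓘(ℝ, E) 𝓘(ℝ, E) (extChartAt 𝓘(ℝ, E) x) x
  show E →L[ℝ] E →L[ℝ] F from (D - D.flip).bilinearComp L L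

/-- `η` is a `k`-contact form on `M`: `ker η` is a nonzero distribution of corank `k`, `ker dη`
has rank `k`, and the two intersect trivially. -/
structure IsKContactForm [IsManifold 𝓘(ℝ, E) ∞ M] {k : ℕ} (η : OneForm E M (Fin k → ℝ)) :
    Prop where
  smooth : SmoothOneForm η
  ker_ne_bot : ∀ x, (η x).ker ≠ ⊥
  corank_ker : ∀ x, Module.finrank ℝ (TangentSpace 𝓘(ℝ, E) x ⧸ (η x).ker) = k
  rank_ker_extD : ∀ x, Module.finrank ℝ (extD η x).ker = k
  ker_inf_ker : ∀ x, (η x).ker ⊓ (extD η x).ker = ⊥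

/-- The `μ`-th Reeb vector field of `η`: its value at `x` is the vector `v` with `η(v) = e_μ` and
`ι_v dη = 0` (see `reeb_spec` and `reeb_unique`). -/
def reeb {k : ℕ} (η : OneForm E M (Fin k → ℝ)) (μ : Fin k) : VField E M := fun x ↦
  Classical.epsilon fun v : TangentSpace 𝓘(ℝ, E) x ↦ η x v = Pi.single μ 1 ∧ extD η x v = 0

/-- The Reeb derivation `R_h = ∑ μ, h^μ R_μ` of an `ℝ^k`-valued function. -/
def reebDerivation {k : ℕ} (η : OneForm E M (Fin k → ℝ)) (h : M → Fin k → ℝ) : VField E M :=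
  fun x ↦ ∑ μ, h x μ • reeb η μ x

/-- `X` is a Lie symmetry of the distribution `ker η`: its Lie bracket with every (locally defined)
smooth vector field with values in `ker η` takes values in `ker η`. -/
def IsLieSymmetryKer [IsManifold 𝓘(ℝ, E) ∞ M] (η : OneForm E M F) (X : VField E M) : Prop :=
  ∀ (U : Set M) (Y : VField E M), IsOpen U → SmoothVFieldOn Y U → (∀ x ∈ U, η x (Y x) = 0) →
    ∀ x ∈ U, η x (VectorField.mlieBracket 𝓘(ℝ, E) X Y x) = 0

/-- `X` is an `η`-Hamiltonian vector field with `η`-Hamiltonian `k`-function `h = -ι_X η`. -/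
structure IsHamiltonian [IsManifold 𝓘(ℝ, E) ∞ M] {k : ℕ} (η : OneForm E M (Fin k → ℝ))
    (X : VField E M) (h : M → Fin k → ℝ) : Prop where
  smooth : SmoothVField X
  lieSymmetry : IsLieSymmetryKer η X
  eq_neg : ∀ x, h x = -η x (X x)

/-- `f = {h₁, h₂}_η`, i.e. `f = η([X₁, X₂])`, where `X₁`, `X₂` are the `η`-Hamiltonian vector
fields of `h₁`, `h₂`. -/
def IsBracket [IsManifold 𝓘(ℝ, E) ∞ M] {k : ℕ} (η : OneForm E M (Fin k → ℝ))
    (h₁ h₂ f : M → Fin k → ℝ) : Prop :=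
  ∃ X₁ X₂ : VField E M, IsHamiltonian η X₁ h₁ ∧ IsHamiltonian η X₂ h₂ ∧
    ∀ x, f x = η x (VectorField.mlieBracket 𝓘(ℝ, E) X₁ X₂ x)

/-- The smooth vector fields `Xs 1, …, Xs r` are a basis of an `r`-dimensional real Lie algebra of
vector fields and `X(t, x) = ∑ α, b_α(t) Xs_α(x)` for continuous functions `b_α`. That is, `X` is a
Lie system and `Xs` is a basis of a Vessiot–Guldberg Lie algebra of `X`. -/
structure IsLieSystemWith [IsManifold 𝓘(ℝ, E) ∞ M] {r : ℕ} (X : ℝ → VField E M)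
    (Xs : Fin r → VField E M) : Prop where
  smooth : ∀ α, SmoothVField (Xs α)
  linearIndependent : LinearIndependent ℝ Xs
  bracket_mem : ∀ α β, VectorField.mlieBracket 𝓘(ℝ, E) (Xs α) (Xs β) ∈
    Submodule.span ℝ (Set.range Xs)
  decomposition : ∃ b : Fin r → ℝ → ℝ, (∀ α, Continuous (b α)) ∧
    ∀ t x, X t x = ∑ α, b α t • Xs α x

/-- `γ` is a solution on the set of times `s` of the system `dx/dt = X(t, x)`. -/
def IsSolutionOn (X : ℝ → VField E M) (γ : ℝ → M) (s : Set ℝ) : Prop :=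
  ∀ t ∈ s, HasMFDerivWithinAt 𝓘(ℝ, ℝ) 𝓘(ℝ, E) γ s t
    ((1 : ℝ →L[ℝ] ℝ).smulRight (X t (γ t)))

/-- `S` is invariant under the dynamics of `X`: a solution defined on an interval which meets `S`
at some time is in `S` at all times. -/
def IsInvariantUnder (X : ℝ → VField E M) (S : Set M) : Prop :=
  ∀ (s : Set ℝ) (γ : ℝ → M), s.OrdConnected → IsSolutionOn X γ s →
    ∀ t₀ ∈ s, γ t₀ ∈ S → ∀ t ∈ s, γ t ∈ S

/-- `S` is an embedded smooth submanifold of `M`: around each of its points there is a smooth chart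
in which `S` is a piece of an affine subspace. -/
def IsEmbeddedSubmanifold (E : Type*) [NormedAddCommGroup E] [NormedSpace ℝ E]
    {M : Type*} [TopologicalSpace M] [ChartedSpace E M] (S : Set M) : Prop :=
  ∀ x ∈ S, ∃ φ ∈ IsManifold.maximalAtlas 𝓘(ℝ, E) ∞ M, x ∈ φ.source ∧
    ∃ P : Submodule ℝ E, ∀ y ∈ φ.source, y ∈ S ↔ φ y - φ x ∈ P

/-- `v` is tangent to `S` at `x`: it is the velocity at `0` of a curve through `x` that is
smooth near `0` and takes values in `S` there. -/
def IsTangentAt (S : Set M) (x : M) (v : TangentSpace 𝓘(ℝ, E) x) : Prop :=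
  ∃ γ : ℝ → M, γ 0 = x ∧ ContMDiffAt 𝓘(ℝ, ℝ) 𝓘(ℝ, E) ∞ γ 0 ∧ (∀ᶠ t in 𝓝 0, γ t ∈ S) ∧
    HasMFDerivAt 𝓘(ℝ, ℝ) 𝓘(ℝ, E) γ 0 ((1 : ℝ →L[ℝ] ℝ).smulRight (show E from v))

end Geometry

section MomentumMap

variable {M : Type*} {𝔤 : Type*} [LieRing 𝔤] [LieAlgebra ℝ 𝔤] {r k : ℕ}

/-- The momentum map `J(x) = ∑ α, v^α ⊗ h_α(x) ∈ 𝔤* ⊗ ℝ^k`. -/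
def momentumMap (v : Module.Basis (Fin r) ℝ (Module.Dual ℝ 𝔤)) (h : Fin r → M → Fin k → ℝ)
    (x : M) : Module.Dual ℝ 𝔤 ⊗[ℝ] (Fin k → ℝ) :=
  ∑ α, v α ⊗ₜ[ℝ] h α x

/-- The contraction `J^θ = ⟨J, θ⟩ : M → 𝔤*` of the momentum map with `θ ∈ (ℝ^k)*`. -/
def momentumMapAlong (v : Module.Basis (Fin r) ℝ (Module.Dual ℝ 𝔤)) (h : Fin r → M → Fin k → ℝ)
    (θ : Module.Dual ℝ (Fin k → ℝ)) (x : M) : Module.Dual ℝ 𝔤 :=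
  TensorProduct.rid ℝ (Module.Dual ℝ 𝔤)
    (LinearMap.lTensor (Module.Dual ℝ 𝔤) θ (momentumMap v h x))

/-- The zero level of `J^θ`. -/
def zeroLevel (v : Module.Basis (Fin r) ℝ (Module.Dual ℝ 𝔤)) (h : Fin r → M → Fin k → ℝ)
    (θ : Module.Dual ℝ (Fin k → ℝ)) : Set M :=
  {x | momentumMapAlong v h θ x = 0}

end MomentumMap

section Reeb

variable {E : Type*} [NormedAddCommGroup E] [NormedSpace ℝ E]
  {M : Type*} [TopologicalSpace M] [ChartedSpace E M] [IsManifold 𝓘(ℝ, E) ∞ M]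
  {k : ℕ} {η : OneForm E M (Fin k → ℝ)}

theorem reeb_unique (hη : IsKContactForm η) (x : M) {v w : TangentSpace 𝓘(ℝ, E) x}
    (hvw : η x v = η x w) (hv : extD η x v = 0) (hw : extD η x w = 0) : v = w := by
  have h : v - w ∈ (η x).ker ⊓ (extD η x).ker :=
    ⟨by simp [LinearMap.mem_ker, hvw], by simp [LinearMap.mem_ker, hv, hw]⟩
  rw [hη.ker_inf_ker x] at h
  exact sub_eq_zero.mp ((Submodule.mem_bot ℝ).mp h)

theorem reeb_spec [FiniteDimensional ℝ E] (hη : IsKContactForm η) (μ : Fin k) (x : M) :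
    η x (reeb η μ x) = Pi.single μ 1 ∧ extD η x (reeb η μ x) = 0 := by
  let g : (extD η x).ker →ₗ[ℝ] (Fin k → ℝ) := (η x).toLinearMap.domRestrict (extD η x).ker
  have hinj : Function.Injective g := by
    intro a b hab
    exact Subtype.ext (reeb_unique hη x hab a.2 b.2)
  have : FiniteDimensional ℝ (TangentSpace 𝓘(ℝ, E) x) := inferInstanceAs (FiniteDimensional ℝ E)
  have hsurj : Function.Surjective g :=
    (LinearMap.injective_iff_surjective_of_finrank_eq_finrank
      (by rw [hη.rank_ker_extD x]; simp)).mp hinj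
  obtain ⟨a, ha⟩ := hsurj (Pi.single μ 1)
  exact Classical.epsilon_spec
    (p := fun v : TangentSpace 𝓘(ℝ, E) x ↦ η x v = Pi.single μ 1 ∧ extD η x v = 0)
    ⟨a.1, ha, a.2⟩

end Reeb

end

end KContact

/-! On `S` all the functions `θ(h α)` vanish, and the point is that every `Xs α` is tangent to `S`.
Write `X = Xs α`, `Y = Xs β` and let `R` be the Reeb derivation of `h β`. Since `η(R) = h β =
-η(Y)`, the vector `Y + R` lies in `ker η`. As `X` is a Lie symmetry, `L_X η` vanishes on `ker η`,
so `(L_X η)(Y) = -(L_X η)(R)`. The left side is `X(η(Y)) - η([X, Y])`; by Cartan's formula and `ι_R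
dη = 0`, the right side is `-d(η(X))(R)`. Hence `d(η(Y))(X) = η([X, Y]) - d(η(X))(R)`, which is
`fderivContraction_apply_eq`.

Apply `θ` at a point of `S`. The bracket is a constant-coefficient combination of the `Xs γ`, so its
term vanishes; the other vanishes because `R` is tangent to `S`. Thus `X` annihilates every `θ(h
β)`, and weak regularity makes it tangent to `S`.

Tangency gives invariance (`isInvariantUnder_of_isTangentAt`): in a slice chart the transverse
component of a solution satisfies a Grönwall inequality, so the times spent in the closed set `S`
form a clopen subset of the interval. -/

namespace KContact

/-! ### Invariance of closed submanifolds under tangent time-dependent fields. -/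

section FlowInvariance

variable {E : Type*} [NormedAddCommGroup E] [NormedSpace ℝ E]

/-- A function which vanishes at the left end of an interval and whose derivative is bounded by
a multiple of its norm vanishes on the interval. -/
theorem eq_zero_of_norm_deriv_le_right {f f' : ℝ → E} {a b K : ℝ}
    (hf : ∀ t ∈ Set.Icc a b, HasDerivWithinAt f (f' t) (Set.Icc a b) t)
    (hK : ∀ t ∈ Set.Icc a b, ‖f' t‖ ≤ K * ‖f t‖) (ha : f a = 0) :
    ∀ t ∈ Set.Icc a b, f t = 0 := by
  refine eq_zero_of_abs_deriv_le_mul_abs_self_of_eq_zero_right (f' := f') (K := K)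
    (fun t ht ↦ (hf t ht).continuousWithinAt) (fun t ht ↦ ?_) ha
    (fun t ht ↦ hK t ⟨ht.1, ht.2.le⟩)
  exact ((hf t ⟨ht.1, ht.2.le⟩).mono (Set.Icc_subset_Icc_left ht.1)).mono_of_mem_nhdsWithin
    (Icc_mem_nhdsGE ht.2)

/-- A function which vanishes at a point of an interval and whose derivative near that point is
bounded by a multiple of its norm vanishes near that point. -/
theorem eventually_eq_zero_of_norm_deriv_le {f f' : ℝ → E} {s : Set ℝ} {t₀ K : ℝ}
    (hs : s.OrdConnected) (ht₀ : t₀ ∈ s) (h₀ : f t₀ = 0)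
    (hf : ∀ᶠ t in 𝓝[s] t₀, HasDerivWithinAt f (f' t) s t ∧ ‖f' t‖ ≤ K * ‖f t‖) :
    ∀ᶠ t in 𝓝[s] t₀, f t = 0 := by
  obtain ⟨ε, hε, H⟩ := Metric.mem_nhdsWithin_iff.1 hf
  refine Metric.mem_nhdsWithin_iff.2 ⟨ε, hε, fun t ⟨ht, hts⟩ ↦ ?_⟩
  rw [Metric.mem_ball, Real.dist_eq, abs_lt] at ht
  have key : ∀ τ ∈ Set.uIcc t₀ t,
      τ ∈ s ∧ HasDerivWithinAt f (f' τ) s τ ∧ ‖f' τ‖ ≤ K * ‖f τ‖ := fun τ hτ ↦ by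
    have hτs : τ ∈ s := hs.uIcc_subset ht₀ hts hτ
    refine ⟨hτs, H ⟨?_, hτs⟩⟩
    rw [Metric.mem_ball, Real.dist_eq, abs_lt]
    rcases Set.mem_uIcc.1 hτ with h | h <;> constructor <;> linarith [h.1, h.2, ht.1, ht.2]
  rcases le_total t₀ t with hle | hle
  · rw [Set.uIcc_of_le hle] at key
    exact eq_zero_of_norm_deriv_le_right (fun τ hτ ↦ (key τ hτ).2.1.mono fun σ hσ ↦ (key σ hσ).1)
      (fun τ hτ ↦ (key τ hτ).2.2) h₀ t (Set.right_mem_Icc.2 hle)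
  -- Times before `t₀` are handled by the reflection `τ ↦ -τ`.
  · rw [Set.uIcc_of_ge hle] at key
    have hmaps : Set.MapsTo (fun τ : ℝ ↦ -τ) (Set.Icc (-t₀) (-t)) (Set.Icc t t₀) := fun τ hτ ↦
      ⟨by linarith [hτ.2], by linarith [hτ.1]⟩
    have := eq_zero_of_norm_deriv_le_right (f := fun τ ↦ f (-τ)) (f' := fun τ ↦ -f' (-τ))
      (a := -t₀) (b := -t) (K := K) (fun τ hτ ↦ ?_) (fun τ hτ ↦ ?_) (by simpa using h₀) (-t)
      (Set.right_mem_Icc.2 (by linarith))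
    · simpa using this
    · have h1 := (key (-τ) (hmaps hτ)).2.1.mono fun σ hσ ↦ (key σ hσ).1
      simpa using! h1.scomp τ (hasDerivWithinAt_neg τ _) hmaps
    · simpa using (key (-τ) (hmaps hτ)).2.2

/-- A solution of `c' = ∑ α, b α • V α c` stays in an affine subspace as long as the vector
fields `V α` are tangent to it. -/
theorem eventually_sub_mem_of_tangent [FiniteDimensional ℝ E] {ι : Type*} [Fintype ι]
    {V : ι → E → E} {b : ι → ℝ → ℝ} {c : ℝ → E} {s : Set ℝ} {t₀ : ℝ} (P : Submodule ℝ E)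
    (hV : ∀ α, ContDiffAt ℝ 1 (V α) (c t₀)) (hb : ∀ α, Continuous (b α))
    (hP : ∀ᶠ u in 𝓝 (c t₀), u - c t₀ ∈ P → ∀ α, V α u ∈ P)
    (hs : s.OrdConnected) (ht₀ : t₀ ∈ s)
    (hc : ∀ᶠ t in 𝓝[s] t₀, HasDerivWithinAt c (∑ α, b α t • V α (c t)) s t) :
    ∀ᶠ t in 𝓝[s] t₀, c t - c t₀ ∈ P := by
  -- Here `p'` is a projection onto `P` and `q = id - p'` has kernel exactly `P`, so the claim
  -- becomes the vanishing of the transverse component `q (c t - c t₀)`.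
  obtain ⟨p, hp⟩ := Submodule.ClosedComplemented.of_finiteDimensional P
  let p' : E →L[ℝ] E := P.subtypeL ∘L p
  let q : E →L[ℝ] E := ContinuousLinearMap.id ℝ E - p'
  have hp' : ∀ u, p' u ∈ P := fun u ↦ (p u).2
  have hq : ∀ u, q u = u - p' u := fun u ↦ rfl
  have hq0 : ∀ u ∈ P, q u = 0 := fun u hu ↦ by
    rw [hq, sub_eq_zero]; exact congrArg Subtype.val (hp ⟨u, hu⟩).symm
  have hqP : ∀ u, q u = 0 → u ∈ P := fun u hu ↦ by
    rw [hq, sub_eq_zero] at hu; rw [hu]; exact hp' u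
  choose K T hT hLip using fun α ↦ (hV α).exists_lipschitzOnWith
  have hcont : Filter.Tendsto c (𝓝[s] t₀) (𝓝 (c t₀)) :=
    (hc.self_of_nhdsWithin ht₀).continuousWithinAt
  have hproj : Filter.Tendsto (fun u ↦ c t₀ + p' (u - c t₀)) (𝓝 (c t₀)) (𝓝 (c t₀)) := by
    have : ContinuousAt (fun u ↦ c t₀ + p' (u - c t₀)) (c t₀) := by fun_prop
    simpa [ContinuousAt] using this
  have hbd : ∀ᶠ t in 𝓝[s] t₀, ∀ α, |b α t| ≤ |b α t₀| + 1 := by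
    refine Filter.eventually_all.2 fun α ↦ nhdsWithin_le_nhds ?_
    have : Filter.Tendsto (fun t ↦ |b α t|) (𝓝 t₀) (𝓝 |b α t₀|) :=
      (hb α).abs.continuousAt
    exact (this.eventually_lt_const (lt_add_one _)).mono fun t ht ↦ ht.le
  -- The point `c t₀ + p' (u - c t₀)` is the projection of `u` to the affine subspace. There `V α`
  -- takes values in `P`, which `q` kills.
  have hu : ∀ᶠ u in 𝓝 (c t₀), (∀ α, u ∈ T α) ∧ (∀ α, c t₀ + p' (u - c t₀) ∈ T α) ∧
      ∀ α, V α (c t₀ + p' (u - c t₀)) ∈ P := by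
    filter_upwards [Filter.eventually_all.2 hT,
      hproj.eventually (Filter.eventually_all.2 hT), hproj.eventually hP] with u h1 h2 h3
    exact ⟨h1, h2, h3 (by rw [add_sub_cancel_left]; exact hp' _)⟩
  -- In `K`, the factor `|b α t₀| + 1` bounds `b α` near `t₀`, and `‖q‖ * K α` bounds `q (V α (c
  -- t))` through the Lipschitz estimate between `c t` and its projection, whose difference is `q (c
  -- t - c t₀)`.
  have := eventually_eq_zero_of_norm_deriv_le (f := fun t ↦ q (c t - c t₀))
    (f' := fun t ↦ q (∑ α, b α t • V α (c t)))
    (K := ∑ α, (|b α t₀| + 1) * (‖q‖ * K α)) hs ht₀ (by simp) ?_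
  · exact this.mono fun t ht ↦ hqP _ ht
  filter_upwards [hc, hbd, hcont hu] with t h1 h2 ⟨h3, h4, h5⟩
  refine ⟨(q.hasFDerivAt.comp_hasDerivWithinAt t (h1.sub_const _)), ?_⟩
  rw [map_sum, Finset.sum_mul]
  refine (norm_sum_le _ _).trans (Finset.sum_le_sum fun α _ ↦ ?_)
  rw [map_smul, norm_smul, Real.norm_eq_abs, mul_assoc]
  refine mul_le_mul (h2 α) ?_ (norm_nonneg _) (by positivity)
  have e1 : q (V α (c t)) = q (V α (c t) - V α (c t₀ + p' (c t - c t₀))) := by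
    rw [map_sub, hq0 _ (h5 α), sub_zero]
  have e2 : c t - (c t₀ + p' (c t - c t₀)) = q (c t - c t₀) := by rw [hq]; abel
  rw [e1, mul_assoc]
  refine (q.le_opNorm _).trans (mul_le_mul_of_nonneg_left ?_ (norm_nonneg _))
  have := (hLip α).dist_le_mul _ (h3 α) _ (h4 α)
  rwa [dist_eq_norm, dist_eq_norm, e2] at this

variable {M : Type*} [TopologicalSpace M] [ChartedSpace E M]

/-- If `φ` maps the points of `S` near `y` into a translate of a closed subspace `P`, then its
derivative at `y` maps the vectors tangent to `S` into `P`. -/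
theorem mfderiv_mem_of_isTangentAt {φ : M → E} {S : Set M} {y : M} {a : E} {P : Submodule ℝ E}
    (hPc : IsClosed (P : Set E)) (hφ : MDifferentiableAt 𝓘(ℝ, E) 𝓘(ℝ, E) φ y)
    (hP : ∀ᶠ z in 𝓝 y, z ∈ S → φ z - a ∈ P) {w : TangentSpace 𝓘(ℝ, E) y}
    (hw : IsTangentAt S y w) : (mfderiv 𝓘(ℝ, E) 𝓘(ℝ, E) φ y w : E) ∈ P := by
  obtain ⟨c, rfl, hcont, hcS, hcd⟩ := hw
  let L : E →L[ℝ] E := mfderiv 𝓘(ℝ, E) 𝓘(ℝ, E) φ (c 0)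
  let w' : E := w
  have h1 : HasFDerivAt (φ ∘ c) (L ∘L (1 : ℝ →L[ℝ] ℝ).smulRight w') 0 :=
    (hφ.hasMFDerivAt.comp 0 hcd).hasFDerivAt
  have h2 : HasDerivAt (φ ∘ c) (L w') 0 := h1.hasDerivAt.congr_deriv (by simp)
  have hev : ∀ᶠ t in 𝓝 (0 : ℝ), φ (c t) - a ∈ P := by
    filter_upwards [hcont.continuousAt.eventually hP, hcS] with t h3 h4 using h3 h4
  -- The velocity is a limit of difference quotients, which lie in the closed subspace `P`.
  refine hPc.mem_of_tendsto (hasDerivAt_iff_tendsto_slope.1 h2) ?_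
  filter_upwards [nhdsWithin_le_nhds hev] with t ht
  rw [slope_def_module]
  refine P.smul_mem _ ?_
  simpa using P.sub_mem ht hev.self_of_nhds

variable [IsManifold 𝓘(ℝ, E) ∞ M]

/-- The expression of a smooth vector field in a smooth chart is smooth. -/
theorem contDiffOn_mfderiv_apply_vField {X : VField E M} (hX : SmoothVField X)
    {φ : OpenPartialHomeomorph M E} (hφ : φ ∈ IsManifold.maximalAtlas 𝓘(ℝ, E) ∞ M) :
    ContDiffOn ℝ ∞ (fun u ↦ (mfderiv 𝓘(ℝ, E) 𝓘(ℝ, E) φ (φ.symm u) (X (φ.symm u)) : E))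
      φ.target := by
  have : IsManifold 𝓘(ℝ, E) 1 M := IsManifold.of_le (n := ∞) (by norm_cast)
  have h1 := (contMDiffOn_of_mem_maximalAtlas hφ).contMDiffOn_tangentMapWithin (m := ∞)
    (by norm_cast) φ.open_source.uniqueMDiffOn
  have h2 : ContMDiffOn 𝓘(ℝ, E) 𝓘(ℝ, E).tangent ∞
      (fun u ↦ (⟨φ.symm u, X (φ.symm u)⟩ : TangentBundle 𝓘(ℝ, E) M)) φ.target :=
    hX.comp_contMDiffOn (contMDiffOn_symm_of_mem_maximalAtlas hφ)
  have h3 := h1.comp h2 fun u hu ↦ φ.map_target hu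
  have h4 : ContMDiffOn 𝓘(ℝ, E) 𝓘(ℝ, E).tangent ∞
      (fun u ↦ (⟨u, mfderiv 𝓘(ℝ, E) 𝓘(ℝ, E) φ (φ.symm u) (X (φ.symm u))⟩ :
        TangentBundle 𝓘(ℝ, E) E)) φ.target := by
    refine h3.congr fun u hu ↦ ?_
    simp only [Function.comp_def, tangentMapWithin]
    rw [mfderivWithin_of_isOpen φ.open_source (φ.map_target hu)]
    congr 1
    exact (φ.right_inv hu).symm
  exact contMDiffOn_vectorSpace_iff_contDiffOn.1 h4

/-- A closed embedded submanifold to which the vector fields of a basis of a Vessiot–Guldberg Lie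
algebra of a Lie system are tangent is invariant under the dynamics of the system. -/
theorem isInvariantUnder_of_isTangentAt [FiniteDimensional ℝ E] {r : ℕ} {X : ℝ → VField E M}
    {Xs : Fin r → VField E M} (hX : IsLieSystemWith X Xs) {S : Set M} (hS : IsClosed S)
    (hsub : IsEmbeddedSubmanifold E S) (htan : ∀ α, ∀ x ∈ S, IsTangentAt S x (Xs α x)) :
    IsInvariantUnder X S := by
  intro s γ hs hγ t₀ ht₀ hγ₀ t ht
  obtain ⟨b, hb, hXb⟩ := hX.decomposition
  have hγc : ContinuousOn γ s := fun τ hτ ↦ (hγ τ hτ).continuousWithinAt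
  have : PreconnectedSpace s := Subtype.preconnectedSpace hs.isPreconnected
  -- Connectedness of the interval: this set of times is nonempty, closed because `S` is, and open
  -- by the local argument in a slice chart.
  suffices h : {τ : s | γ τ ∈ S} = Set.univ from h.ge (Set.mem_univ (⟨t, ht⟩ : s))
  refine IsClopen.eq_univ ⟨hS.preimage (continuousOn_iff_continuous_domRestrict.1 hγc), ?_⟩
    ⟨⟨t₀, ht₀⟩, hγ₀⟩
  refine isOpen_iff_mem_nhds.2 fun ⟨τ, hτ⟩ hτS ↦ ?_
  suffices h : ∀ᶠ σ in 𝓝[s] τ, γ σ ∈ S from by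
    rw [nhds_subtype_eq_comap_nhdsWithin]
    exact Filter.preimage_mem_comap h
  obtain ⟨φ, hφ, hxφ, P, hP⟩ := hsub (γ τ) hτS
  have hPc : IsClosed (P : Set E) := P.closed_of_finiteDimensional
  have hev : ∀ᶠ σ in 𝓝[s] τ, γ σ ∈ φ.source := hγc τ hτ (φ.open_source.mem_nhds hxφ)
  have hφd : ∀ y ∈ φ.source, MDifferentiableAt 𝓘(ℝ, E) 𝓘(ℝ, E) φ y := fun y hy ↦
    (contMDiffAt_of_mem_maximalAtlas hφ hy).mdifferentiableAt (by norm_cast)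
  have key := eventually_sub_mem_of_tangent (c := fun σ ↦ φ (γ σ)) (t₀ := τ) P
    (V := fun α u ↦ (mfderiv 𝓘(ℝ, E) 𝓘(ℝ, E) φ (φ.symm u) (Xs α (φ.symm u)) : E)) (b := b)
    (fun α ↦ ((contDiffOn_mfderiv_apply_vField (hX.smooth α) hφ).contDiffAt
      (φ.open_target.mem_nhds (φ.map_source hxφ))).of_le (by norm_cast)) hb ?_ hs hτ ?_
  · filter_upwards [key, hev] with σ h1 h2
    exact (hP _ h2).2 h1
  · filter_upwards [φ.open_target.mem_nhds (φ.map_source hxφ)] with u hu huP α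
    have hyφ := φ.map_target hu
    have hyS : φ.symm u ∈ S := (hP _ hyφ).2 (by rwa [φ.right_inv hu])
    exact mfderiv_mem_of_isTangentAt hPc (hφd _ hyφ)
      ((φ.open_source.eventually_mem hyφ).mono fun z hz hzS ↦ (hP z hz).1 hzS) (htan α _ hyS)
  · filter_upwards [hev, self_mem_nhdsWithin] with σ hσφ hσs
    let L : E →L[ℝ] E := mfderiv 𝓘(ℝ, E) 𝓘(ℝ, E) φ (γ σ)
    let w : E := X σ (γ σ)
    let Z : Fin r → E := fun α ↦ Xs α (γ σ)
    have h1 : HasFDerivWithinAt (φ ∘ γ) (L ∘L (1 : ℝ →L[ℝ] ℝ).smulRight w) s σ :=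
      ((hφd _ hσφ).hasMFDerivAt.comp_hasMFDerivWithinAt σ (hγ σ hσs)).hasFDerivWithinAt
    refine h1.hasDerivWithinAt.congr_deriv ?_
    have hw : w = ∑ α, b α σ • Z α := hXb σ (γ σ)
    rw [φ.left_inv hσφ]
    simp only [ContinuousLinearMap.comp_apply, ContinuousLinearMap.smulRight_apply,
      one_apply_eq_self, one_smul, hw, map_sum, map_smul]
    rfl

end FlowInvariance

/-! ### Vector fields, one-forms and Lie brackets in the preferred charts. -/

section Chart

variable {E : Type*} [NormedAddCommGroup E] [NormedSpace ℝ E]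
  {M : Type*} [TopologicalSpace M] [ChartedSpace E M]
  {F : Type*} [NormedAddCommGroup F] [NormedSpace ℝ F]

/-- The expression of the vector field `X` in the preferred chart at `x₀`. -/
noncomputable def vFieldRep (X : VField E M) (x₀ : M) (u : E) : E :=
  mfderiv 𝓘(ℝ, E) 𝓘(ℝ, E) (extChartAt 𝓘(ℝ, E) x₀) ((extChartAt 𝓘(ℝ, E) x₀).symm u)
    (X ((extChartAt 𝓘(ℝ, E) x₀).symm u))

/-- The vector field on `M` whose expression in the preferred chart at `x₀` is `W`. -/
noncomputable def vFieldOfRep (x₀ : M) (W : E → E) : VField E M := fun y ↦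
  mfderiv 𝓘(ℝ, E) 𝓘(ℝ, E) (chartAt E x₀).symm (chartAt E x₀ y) (W (chartAt E x₀ y))

variable [IsManifold 𝓘(ℝ, E) ∞ M]

theorem isManifold_one : IsManifold 𝓘(ℝ, E) 1 M := IsManifold.of_le (n := ∞) (by norm_cast)

theorem mfderiv_extChartAt_mfderiv_symm {x₀ : M} {u : E} (hu : u ∈ (chartAt E x₀).target)
    (w : E) :
    mfderiv 𝓘(ℝ, E) 𝓘(ℝ, E) (extChartAt 𝓘(ℝ, E) x₀) ((chartAt E x₀).symm u)
      (mfderiv 𝓘(ℝ, E) 𝓘(ℝ, E) (chartAt E x₀).symm u w) = w := by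
  have := isManifold_one (E := E) (M := M)
  have h := mfderiv_extChartAt_comp_mfderivWithin_extChartAt_symm (I := 𝓘(ℝ, E)) (x := x₀) (y := u)
    (by simpa using hu)
  rw [modelWithCornersSelf_coe, Set.range_id, mfderivWithin_univ] at h
  exact congrArg (fun L ↦ L w) h

theorem mfderiv_symm_mfderiv_extChartAt {x₀ : M} {u : E} (hu : u ∈ (chartAt E x₀).target)
    (w : TangentSpace 𝓘(ℝ, E) ((chartAt E x₀).symm u)) :
    mfderiv 𝓘(ℝ, E) 𝓘(ℝ, E) (chartAt E x₀).symm u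
      (mfderiv 𝓘(ℝ, E) 𝓘(ℝ, E) (extChartAt 𝓘(ℝ, E) x₀) ((chartAt E x₀).symm u) w) = w := by
  have := isManifold_one (E := E) (M := M)
  have h := mfderivWithin_extChartAt_symm_comp_mfderiv_extChartAt (I := 𝓘(ℝ, E)) (x := x₀) (y := u)
    (by simpa using hu)
  rw [modelWithCornersSelf_coe, Set.range_id, mfderivWithin_univ] at h
  exact congrArg (fun L ↦ L w) h

/-- The fibre `TangentSpace` at `x` is identified with `E` through the preferred chart at `x`, so
the derivative of that chart at `x` is the identity. This lets all later computations at `x` be done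
with vectors of `E`. -/
theorem vFieldRep_self (X : VField E M) (x : M) : vFieldRep X x (extChartAt 𝓘(ℝ, E) x x) = X x := by
  have := isManifold_one (E := E) (M := M)
  unfold vFieldRep
  rw [extChartAt_to_inv, mfderiv_extChartAt_self]
  rfl

theorem chartRep_self (η : OneForm E M F) (x : M) :
    chartRep η x (extChartAt 𝓘(ℝ, E) x x) = η x := by
  have := isManifold_one (E := E) (M := M)
  have h := mfderivWithin_range_extChartAt_symm (I := 𝓘(ℝ, E)) (x := x)
  rw [modelWithCornersSelf_coe, Set.range_id, mfderivWithin_univ] at h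
  unfold chartRep
  rw [h, extChartAt_to_inv]
  rfl

theorem extD_apply (η : OneForm E M F) (x : M) (v w : TangentSpace 𝓘(ℝ, E) x) :
    extD η x v w = fderiv ℝ (chartRep η x) (extChartAt 𝓘(ℝ, E) x x) v w -
      fderiv ℝ (chartRep η x) (extChartAt 𝓘(ℝ, E) x x) w v := by
  have := isManifold_one (E := E) (M := M)
  unfold extD
  rw [mfderiv_extChartAt_self]
  rfl

theorem chartRep_vFieldRep (η : OneForm E M F) (X : VField E M) {x₀ : M} {u : E}
    (hu : u ∈ (chartAt E x₀).target) :
    chartRep η x₀ u (vFieldRep X x₀ u) = η ((chartAt E x₀).symm u) (X ((chartAt E x₀).symm u)) :=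
  congrArg (η ((chartAt E x₀).symm u)) (mfderiv_symm_mfderiv_extChartAt hu _)

theorem vFieldRep_vFieldOfRep (W : E → E) {x₀ : M} {u : E} (hu : u ∈ (chartAt E x₀).target) :
    vFieldRep (vFieldOfRep x₀ W) x₀ u = W u := by
  refine Eq.trans ?_ (mfderiv_extChartAt_mfderiv_symm hu (W u))
  unfold vFieldRep vFieldOfRep
  simp only [mfld_simps]
  rw [(chartAt E x₀).right_inv hu]
  rfl

theorem contDiffOn_vFieldRep {X : VField E M} (hX : SmoothVField X) (x₀ : M) :
    ContDiffOn ℝ ∞ (vFieldRep X x₀) (chartAt E x₀).target :=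
  contDiffOn_mfderiv_apply_vField hX (IsManifold.chart_mem_maximalAtlas x₀)

theorem differentiableAt_vFieldRep {X : VField E M} (hX : SmoothVField X) (x : M) :
    DifferentiableAt ℝ (vFieldRep X x) (extChartAt 𝓘(ℝ, E) x x) :=
  ((contDiffOn_vFieldRep hX x).contDiffAt
    ((chartAt E x).open_target.mem_nhds (mem_chart_target E x))).differentiableAt (by norm_cast)

/-- The manifold bracket is the vector space bracket of the two pullbacks to the chart at `x`,
carried back by the inverse of the chart's derivative, here the identity. -/
theorem mlieBracket_eq_fderiv_vFieldRep (X Y : VField E M) (x : M) :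
    VectorField.mlieBracket 𝓘(ℝ, E) X Y x =
      fderiv ℝ (vFieldRep Y x) (extChartAt 𝓘(ℝ, E) x x) (X x) -
        fderiv ℝ (vFieldRep X x) (extChartAt 𝓘(ℝ, E) x x) (Y x) := by
  have := isManifold_one (E := E) (M := M)
  have key : ∀ Z : VField E M, VectorField.mpullbackWithin 𝓘(ℝ, E) 𝓘(ℝ, E)
      (extChartAt 𝓘(ℝ, E) x).symm Z (Set.range 𝓘(ℝ, E)) =ᶠ[𝓝 (extChartAt 𝓘(ℝ, E) x x)]
        vFieldRep Z x := fun Z ↦ by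
    filter_upwards [extChartAt_target_mem_nhds (I := 𝓘(ℝ, E)) x] with u hu
    rw [VectorField.mpullbackWithin_apply, ContinuousLinearMap.inverse_eq
      (mfderivWithin_extChartAt_symm_comp_mfderiv_extChartAt hu)
      (mfderiv_extChartAt_comp_mfderivWithin_extChartAt_symm hu)]
    rfl
  rw [← VectorField.mlieBracketWithin_univ, VectorField.mlieBracketWithin_apply]
  refine (congrArg (fun L : E →L[ℝ] E ↦ L.inverse _)
    (mfderiv_extChartAt_self (I := 𝓘(ℝ, E)) (x := x))).trans ?_
  refine (congrArg (fun L : E →L[ℝ] E ↦ L _) ContinuousLinearMap.inverse_id).trans ?_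
  rw [ContinuousLinearMap.id_apply, modelWithCornersSelf_coe, Set.range_id, Set.preimage_univ,
    Set.inter_univ]
  refine (congrFun VectorField.lieBracketWithin_univ _).trans ?_
  rw [modelWithCornersSelf_coe, Set.range_id] at key
  refine ((key X).lieBracket_vectorField_eq (key Y)).trans ?_
  rw [VectorField.lieBracket, vFieldRep_self, vFieldRep_self]

theorem smoothVFieldOn_vFieldOfRep {W : E → E} {x₀ : M} {U : Set E} (hU : IsOpen U)
    (hUt : U ⊆ (chartAt E x₀).target) (hW : ContDiffOn ℝ ∞ W U) :
    SmoothVFieldOn (vFieldOfRep x₀ W) ((chartAt E x₀).source ∩ chartAt E x₀ ⁻¹' U) := by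
  have := isManifold_one (E := E) (M := M)
  have h1 := ((contMDiffOn_symm_of_mem_maximalAtlas (IsManifold.chart_mem_maximalAtlas
    (I := 𝓘(ℝ, E)) (n := ∞) x₀)).mono hUt).contMDiffOn_tangentMapWithin (m := ∞)
    (by norm_cast) hU.uniqueMDiffOn
  have h2 : ContMDiffOn 𝓘(ℝ, E) 𝓘(ℝ, E).tangent ∞
      (fun u ↦ (⟨u, W u⟩ : TangentBundle 𝓘(ℝ, E) E)) U :=
    contMDiffOn_vectorSpace_iff_contDiffOn.2 hW
  have h3 := (h1.comp h2 fun u hu ↦ hu).comp ((contMDiffOn_of_mem_maximalAtlas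
    (IsManifold.chart_mem_maximalAtlas (I := 𝓘(ℝ, E)) (n := ∞) x₀)).mono
      Set.inter_subset_left) fun y hy ↦ hy.2
  refine h3.congr fun y hy ↦ ?_
  simp only [Function.comp_def, tangentMapWithin, vFieldOfRep]
  rw [mfderivWithin_of_isOpen hU hy.2]
  congr 1
  exact ((chartAt E x₀).left_inv hy.1).symm

theorem contMDiffOn_apply_vField {η : OneForm E M F} (hη : SmoothOneForm η) {X : VField E M}
    {U : Set M} (hX : SmoothVFieldOn X U) :
    ContMDiffOn 𝓘(ℝ, E) 𝓘(ℝ, F) ∞ (fun x ↦ η x (X x)) U := by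
  have := isManifold_one (E := E) (M := M)
  intro x hx
  have h := ContMDiffWithinAt.clm_bundle_apply (E₂ := Bundle.Trivial M F) (b := id) (ϕ := η)
    (hη.contMDiffOn (s := U) x hx) (hX x hx)
  exact ((Bundle.contMDiffWithinAt_totalSpace ..).1 h).2

/-- In finite dimension, smoothness of an operator-valued map can be tested on each fixed vector
`w`; the test function is `η` contracted with the coordinate field `vFieldOfRep x₀ (fun _ ↦ w)`. -/
theorem contDiffOn_chartRep [FiniteDimensional ℝ E] {η : OneForm E M F} (hη : SmoothOneForm η)
    (x₀ : M) : ContDiffOn ℝ ∞ (chartRep η x₀) (chartAt E x₀).target := by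
  refine contDiffOn_clm_apply.2 fun w ↦ ?_
  have h1 := contMDiffOn_apply_vField hη (smoothVFieldOn_vFieldOfRep (x₀ := x₀)
    (chartAt E x₀).open_target subset_rfl (contDiffOn_const (c := w)))
  have h2 := h1.comp (contMDiffOn_symm_of_mem_maximalAtlas (IsManifold.chart_mem_maximalAtlas
    (I := 𝓘(ℝ, E)) (n := ∞) x₀)) fun u hu ↦
      ⟨(chartAt E x₀).map_target hu, by simpa [(chartAt E x₀).right_inv hu] using hu⟩
  refine (contMDiffOn_iff_contDiffOn.1 h2).congr fun u hu ↦ ?_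
  simp only [Function.comp_def, vFieldOfRep]
  rw [(chartAt E x₀).right_inv hu]
  rfl

end Chart

/-! ### Lie symmetries of the kernel and the derivative of `η(Y)`. -/

section Hamiltonian

variable {E : Type*} [NormedAddCommGroup E] [NormedSpace ℝ E]
  {F : Type*} [NormedAddCommGroup F] [NormedSpace ℝ F]

/-- Every vector in the kernel of a one-form which is onto is the value of a smooth local section
of the kernel; here in terms of a chart. -/
theorem exists_contDiffOn_mem_ker [FiniteDimensional ℝ F] {e : E → E →L[ℝ] F} {T : Set E}
    (hT : IsOpen T) (he : ContDiffOn ℝ ∞ e T) {u₀ : E} (hu₀ : u₀ ∈ T)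
    (hsurj : Function.Surjective (e u₀)) {w : E} (hw : e u₀ w = 0) :
    ∃ (U : Set E) (W : E → E), IsOpen U ∧ U ⊆ T ∧ u₀ ∈ U ∧ ContDiffOn ℝ ∞ W U ∧
      W u₀ = w ∧ ∀ u ∈ U, e u (W u) = 0 := by
  -- Since `e u₀ ∘ K` is the identity, `e u ∘ K` stays invertible for `u` near `u₀`. The section is
  -- the constant `w` corrected by the element of the range of `K` with the same image under `e u`.
  obtain ⟨K, hK⟩ := (e u₀).exists_rightInverse_of_surjective (LinearMap.range_eq_top.2 hsurj)
  have hA : ContDiffOn ℝ ∞ (fun u ↦ e u ∘L K) T := he.clm_comp contDiffOn_const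
  refine ⟨T ∩ (fun u ↦ e u ∘L K) ⁻¹' Set.range ((↑) : (F ≃L[ℝ] F) → F →L[ℝ] F),
    fun u ↦ w - K ((e u ∘L K).inverse (e u w)),
    hA.continuousOn.isOpen_inter_preimage hT ContinuousLinearEquiv.isOpen,
    Set.inter_subset_left, ⟨hu₀, ContinuousLinearEquiv.refl ℝ F, hK.symm⟩, ?_, ?_, ?_⟩
  · intro u hu
    have h1 : ContDiffWithinAt ℝ ∞ (fun u ↦ (e u ∘L K).inverse) T u :=
      ContDiffAt.comp_contDiffWithinAt u (g := ContinuousLinearMap.inverse)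
        (ContinuousLinearMap.IsInvertible.contDiffAt_map_inverse hu.2) (hA u hu.1)
    exact (contDiffWithinAt_const.sub (K.contDiff.comp_contDiffWithinAt
      (h1.clm_apply ((he u hu.1).clm_apply contDiffWithinAt_const)))).mono Set.inter_subset_left
  · simp [hw]
  · intro u hu
    have h1 : (e u ∘L K) ((e u ∘L K).inverse (e u w)) = e u w :=
      congrArg (fun L ↦ L (e u w)) (ContinuousLinearMap.IsInvertible.self_comp_inverse hu.2)
    rw [map_sub, sub_eq_zero]
    exact h1.symm

/-- The pointwise algebra of the Cartan argument: `e` is `η`, `D` its derivative, `a`, `b`, `c` are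
`X`, `Y`, `R`, and `A`, `B` are the derivatives of `X`, `Y`. Then `hsymm` reads `dη(R, X) = 0` and
`hL` reads `(L_X η)(Y + R) = 0`. -/
theorem contraction_identity {D : E →L[ℝ] E →L[ℝ] F} {e : E →L[ℝ] F} {A B : E →L[ℝ] E} {a b c : E}
    (hsymm : D c a - D a c = 0) (hL : D a (b + c) + e (A (b + c)) = 0) :
    D a b + e (B a) = e (B a - A b) - (D c a + e (A c)) := by
  rw [sub_eq_zero.1 hsymm, map_sub, ← sub_eq_zero, ← hL]
  simp only [map_add]
  abel

variable {M : Type*} [TopologicalSpace M] [ChartedSpace E M] [IsManifold 𝓘(ℝ, E) ∞ M]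

/-- The derivative at `x` of the function `η(Y)`, computed in the chart at `x`. -/
noncomputable def fderivContraction (η : OneForm E M F) (Y : VField E M) (x : M) : E →L[ℝ] F :=
  (fderiv ℝ (chartRep η x) (extChartAt 𝓘(ℝ, E) x x)).flip
      (vFieldRep Y x (extChartAt 𝓘(ℝ, E) x x)) +
    chartRep η x (extChartAt 𝓘(ℝ, E) x x) ∘L fderiv ℝ (vFieldRep Y x) (extChartAt 𝓘(ℝ, E) x x)

theorem fderivContraction_apply (η : OneForm E M F) (Y : VField E M) (x : M) (v : E) :
    fderivContraction η Y x v = fderiv ℝ (chartRep η x) (extChartAt 𝓘(ℝ, E) x x) v (Y x) +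
      chartRep η x (extChartAt 𝓘(ℝ, E) x x)
        (fderiv ℝ (vFieldRep Y x) (extChartAt 𝓘(ℝ, E) x x) v) := by
  rw [← vFieldRep_self Y x]
  rfl

variable [FiniteDimensional ℝ E]

theorem contDiffAt_chartRep {η : OneForm E M F} (hη : SmoothOneForm η) (x : M) :
    ContDiffAt ℝ ∞ (chartRep η x) (extChartAt 𝓘(ℝ, E) x x) :=
  (contDiffOn_chartRep hη x).contDiffAt
    ((chartAt E x).open_target.mem_nhds (mem_chart_target E x))

theorem differentiableAt_chartRep {η : OneForm E M F} (hη : SmoothOneForm η) (x : M) :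
    DifferentiableAt ℝ (chartRep η x) (extChartAt 𝓘(ℝ, E) x x) :=
  (contDiffAt_chartRep hη x).differentiableAt (by norm_cast)

/-- The Lie derivative of a one-form along a Lie symmetry of its kernel vanishes on the kernel. -/
theorem lieDeriv_apply_eq_zero [FiniteDimensional ℝ F] {η : OneForm E M F} (hη : SmoothOneForm η)
    {X : VField E M} (hX : IsLieSymmetryKer η X) {x : M}
    (hsurj : Function.Surjective (η x)) {w : E} (hw : chartRep η x (extChartAt 𝓘(ℝ, E) x x) w = 0) :
    fderiv ℝ (chartRep η x) (extChartAt 𝓘(ℝ, E) x x) (X x) w +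
      chartRep η x (extChartAt 𝓘(ℝ, E) x x)
        (fderiv ℝ (vFieldRep X x) (extChartAt 𝓘(ℝ, E) x x) w) = 0 := by
  set u₀ : E := extChartAt 𝓘(ℝ, E) x x with hu₀
  -- Extend `w` to a local section `W` of `ker η`. The symmetry gives `η(D_X W) = η(D_w X)`, and
  -- differentiating `η(W) = 0` along `X` turns `η(D_X W)` into `-(D_X η)(w)`.
  obtain ⟨U, W, hU, hUt, hxU, hW, hW₀, hker⟩ := exists_contDiffOn_mem_ker
    (chartAt E x).open_target (contDiffOn_chartRep hη x) (u₀ := u₀) (mem_chart_target E x)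
    (by rw [hu₀, chartRep_self]; exact hsurj) hw
  have hrep : ∀ u ∈ U, vFieldRep (vFieldOfRep x W) x u = W u := fun u hu ↦
    vFieldRep_vFieldOfRep W (hUt hu)
  have h0 := hX _ (vFieldOfRep x W) ((chartAt E x).continuousOn.isOpen_inter_preimage
    (chartAt E x).open_source hU) (smoothVFieldOn_vFieldOfRep hU hUt hW) (fun y hy ↦ by
      have h := chartRep_vFieldRep η (vFieldOfRep x W) (hUt hy.2)
      rw [hrep _ hy.2, hker _ hy.2, (chartAt E x).left_inv hy.1] at h
      exact h.symm) x ⟨mem_chart_source E x, hxU⟩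
  have hYx : vFieldOfRep x W x = w := by
    rw [← vFieldRep_self (vFieldOfRep x W) x, ← hu₀, hrep _ hxU, hW₀]
  have hd : fderiv ℝ (vFieldRep (vFieldOfRep x W) x) u₀ = fderiv ℝ W u₀ :=
    Filter.EventuallyEq.fderiv_eq ((hU.eventually_mem hxU).mono hrep)
  rw [mlieBracket_eq_fderiv_vFieldRep, ← hu₀, hd, hYx, ← chartRep_self η x, ← hu₀] at h0
  have hWd : DifferentiableAt ℝ W u₀ :=
    (hW.contDiffAt (hU.mem_nhds hxU)).differentiableAt (by norm_cast)
  have h1 := ((differentiableAt_chartRep hη x).hasFDerivAt.clm_apply hWd.hasFDerivAt)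
  have h2 : (fun u ↦ chartRep η x u (W u)) =ᶠ[𝓝 u₀] fun _ ↦ 0 :=
    (hU.eventually_mem hxU).mono hker
  have h3 : ∀ a : E, chartRep η x u₀ (fderiv ℝ W u₀ a) +
      fderiv ℝ (chartRep η x) u₀ a w = 0 := fun a ↦ by
    have := congrArg (fun L : E →L[ℝ] F ↦ L a)
      ((h1.congr_of_eventuallyEq h2.symm).unique (hasFDerivAt_const (0 : F) u₀))
    simp only [← hu₀, hW₀] at this
    exact this
  have h4 : chartRep η x u₀ (fderiv ℝ W u₀ (X x)) - chartRep η x u₀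
      (fderiv ℝ (vFieldRep X x) u₀ w) = 0 := by
    rw [← map_sub]; exact h0
  rw [← sub_eq_zero.1 h4, add_comm]
  exact h3 _

theorem hasMFDerivAt_contraction {η : OneForm E M F} (hη : SmoothOneForm η) {Y : VField E M}
    (hY : SmoothVField Y) (x : M) :
    HasMFDerivAt 𝓘(ℝ, E) 𝓘(ℝ, F) (fun y ↦ η y (Y y)) x
      (fderivContraction (E := E) (F := F) η Y x) := by
  refine ⟨((contMDiffOn_apply_vField hη hY.contMDiffOn).continuousOn.continuousAt
    Filter.univ_mem), ?_⟩
  have h1 := ((differentiableAt_chartRep hη x).hasFDerivAt.clm_apply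
    (differentiableAt_vFieldRep hY x).hasFDerivAt)
  have h2 : HasFDerivAt (writtenInExtChartAt 𝓘(ℝ, E) 𝓘(ℝ, F) x fun y ↦ η y (Y y))
      (fderivContraction η Y x) (extChartAt 𝓘(ℝ, E) x x) := by
    refine (h1.congr_of_eventuallyEq ?_).congr_fderiv ?_
    · filter_upwards [(chartAt E x).open_target.mem_nhds (mem_chart_target E x)] with u hu
      exact (chartRep_vFieldRep η Y hu).symm
    · rw [fderivContraction, add_comm]
  exact h2.hasFDerivWithinAt

/-- If `X` is a Lie symmetry of `ker η`, `ι_R dη = 0` and `η(R) = -η(Y)` at `x`, then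
`d(η(Y))(X) = η([X, Y]) - d(η(X))(R)` at `x`. -/
theorem fderivContraction_apply_eq [FiniteDimensional ℝ F] {η : OneForm E M F}
    (hη : SmoothOneForm η) {X Y : VField E M} (hX : IsLieSymmetryKer η X) {x : M}
    (hsurj : Function.Surjective (η x)) {R : TangentSpace 𝓘(ℝ, E) x} (hR : extD η x R = 0)
    (hRY : η x R = -η x (Y x)) :
    fderivContraction η Y x (X x) =
      η x (VectorField.mlieBracket 𝓘(ℝ, E) X Y x) - fderivContraction η X x R := by
  have hsymm : fderiv ℝ (chartRep η x) (extChartAt 𝓘(ℝ, E) x x) R (X x) -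
      fderiv ℝ (chartRep η x) (extChartAt 𝓘(ℝ, E) x x) (X x) R = 0 := by
    rw [← extD_apply, hR]; rfl
  have hker : η x (Y x + R) = 0 := by rw [map_add, hRY, add_neg_cancel]
  rw [← chartRep_self η x] at hker
  have hL := lieDeriv_apply_eq_zero hη hX hsurj hker
  rw [mlieBracket_eq_fderiv_vFieldRep, ← chartRep_self η x]
  exact ((fderivContraction_apply η Y x (X x)).trans (contraction_identity hsymm hL)).trans
    (congrArg _ (fderivContraction_apply η X x R).symm)

end Hamiltonian

/-! ### Components of the momentum map. -/

section ZeroLevel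

variable {M : Type*} {𝔤 : Type*} [LieRing 𝔤] [LieAlgebra ℝ 𝔤] {r k : ℕ}
  (v : Module.Basis (Fin r) ℝ (Module.Dual ℝ 𝔤)) (h : Fin r → M → Fin k → ℝ)
  (θ : Module.Dual ℝ (Fin k → ℝ))

theorem momentumMapAlong_eq_sum (x : M) :
    momentumMapAlong v h θ x = ∑ α, θ (h α x) • v α := by
  simp [momentumMapAlong, momentumMap]

theorem mem_zeroLevel_iff {x : M} : x ∈ zeroLevel v h θ ↔ ∀ α, θ (h α x) = 0 := by
  rw [zeroLevel, Set.mem_ofPred_eq, momentumMapAlong_eq_sum]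
  refine ⟨Fintype.linearIndependent_iff.1 v.linearIndependent _, fun hx ↦ ?_⟩
  simp [hx]

/-- Reflexivity of `𝔤` realizes the coordinate functional of `v α` as evaluation at a vector, which
isolates one component of `J^θ`. -/
theorem exists_apply_basis_eq_single [FiniteDimensional ℝ 𝔤] (α : Fin r) :
    ∃ a : 𝔤, ∀ β, v β a = if β = α then 1 else 0 := by
  refine ⟨(Module.evalEquiv ℝ 𝔤).symm (v.coord α), fun β ↦ ?_⟩
  rw [Module.apply_evalEquiv_symm_apply, Module.Basis.coord_apply, Module.Basis.repr_self,
    Finsupp.single_apply]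

end ZeroLevel

/-! ### Tangency of the Hamiltonian fields to the zero level. -/

section Invariance

variable {E : Type*} [NormedAddCommGroup E] [NormedSpace ℝ E] [FiniteDimensional ℝ E]
  {M : Type*} [TopologicalSpace M] [ChartedSpace E M] [IsManifold 𝓘(ℝ, E) ∞ M]
  {k r : ℕ} {η : OneForm E M (Fin k → ℝ)}

theorem IsKContactForm.surjective (hη : IsKContactForm η) (x : M) :
    Function.Surjective (η x) := by
  intro a
  refine ⟨∑ μ, a μ • reeb η μ x, ?_⟩
  rw [map_sum]
  simp_rw [map_smul, (reeb_spec hη _ x).1]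
  exact (pi_eq_sum_univ' a).symm

theorem apply_reebDerivation (hη : IsKContactForm η) (h : M → Fin k → ℝ) (x : M) :
    η x (reebDerivation η h x) = h x := by
  rw [reebDerivation, map_sum]
  simp_rw [map_smul, (reeb_spec hη _ x).1]
  exact (pi_eq_sum_univ' (h x)).symm

theorem extD_reebDerivation (hη : IsKContactForm η) (h : M → Fin k → ℝ) (x : M) :
    extD η x (reebDerivation η h x) = 0 := by
  rw [reebDerivation, map_sum]
  simp_rw [map_smul, (reeb_spec hη _ x).2]
  simp

theorem hasMFDerivAt_momentumMapAlong (hη : IsKContactForm η) {Xs : Fin r → VField E M}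
    {h : Fin r → M → Fin k → ℝ} (hXs : ∀ α, IsHamiltonian η (Xs α) (h α))
    {𝔤 : Type*} [LieRing 𝔤] [LieAlgebra ℝ 𝔤] (v : Module.Basis (Fin r) ℝ (Module.Dual ℝ 𝔤))
    (θ : Module.Dual ℝ (Fin k → ℝ)) (a : 𝔤) (x : M) :
    HasMFDerivAt 𝓘(ℝ, E) 𝓘(ℝ, ℝ) (fun y ↦ momentumMapAlong v h θ y a) x
      (∑ α, (-v α a) • (LinearMap.toContinuousLinearMap θ ∘L
        fderivContraction (E := E) (F := Fin k → ℝ) η (Xs α) x) : E →L[ℝ] ℝ) := by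
  have hg := fun α ↦ hasMFDerivAt_contraction hη.smooth (hXs α).smooth x
  have heq : (fun y ↦ momentumMapAlong v h θ y a) =
      fun y ↦ ∑ α, (-v α a) • LinearMap.toContinuousLinearMap θ (η y (Xs α y)) := by
    funext y
    rw [momentumMapAlong_eq_sum, LinearMap.sum_apply]
    refine Finset.sum_congr rfl fun α _ ↦ ?_
    rw [(hXs α).eq_neg]
    simp [mul_comm]
  rw [heq]
  refine ⟨?_, ?_⟩
  · have hc : ∀ α, ContinuousAt
        (fun y ↦ (-v α a) • LinearMap.toContinuousLinearMap θ (η y (Xs α y))) x := fun α ↦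
      ((LinearMap.toContinuousLinearMap θ).continuous.continuousAt.comp (hg α).1).const_smul (-v α a)
    exact tendsto_finsetSum _ fun α _ ↦ hc α
  · exact HasFDerivWithinAt.fun_sum (u := Finset.univ) fun α _ ↦
      ((LinearMap.toContinuousLinearMap θ).hasFDerivAt.comp_hasFDerivWithinAt _
        (hg α).2).const_smul (-v α a)

/-- At a zero of all `θ(h α)`, if the Reeb derivations annihilate the functions `θ(h α)`, then so do
the vector fields of the Lie system. -/
theorem fderivContraction_apply_mem_ker (hη : IsKContactForm η) {X : ℝ → VField E M}
    {Xs : Fin r → VField E M} (hX : IsLieSystemWith X Xs)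
    {h : Fin r → M → Fin k → ℝ} (hXs : ∀ α, IsHamiltonian η (Xs α) (h α))
    (θ : Module.Dual ℝ (Fin k → ℝ)) {x : M} (hx : ∀ α, θ (h α x) = 0)
    (hR : ∀ α β, θ (fderivContraction η (Xs α) x (reebDerivation η (h β) x)) = 0)
    (α β : Fin r) : θ (fderivContraction η (Xs β) x (Xs α x)) = 0 := by
  have key := fderivContraction_apply_eq hη.smooth (hXs α).lieSymmetry (Y := Xs β)
    (hη.surjective x) (extD_reebDerivation hη (h β) x)
    ((apply_reebDerivation hη (h β) x).trans ((hXs β).eq_neg x))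
  rw [key, map_sub, hR, sub_zero]
  -- At `x` the form `θ ∘ η` kills every `Xs γ`, hence the whole Vessiot–Guldberg algebra, which
  -- contains the bracket.
  have hspan : ∀ Z ∈ Submodule.span ℝ (Set.range Xs), θ (η x (Z x)) = 0 := by
    intro Z hZ
    induction hZ using Submodule.span_induction with
    | mem Z hZ =>
      obtain ⟨γ, rfl⟩ := hZ
      have := hx γ
      rwa [(hXs γ).eq_neg, map_neg, neg_eq_zero] at this
    | zero => simp
    | add Z W _ _ hZ hW => rw [Pi.add_apply, map_add, map_add, hZ, hW, add_zero]
    | smul c Z _ hZ => rw [Pi.smul_apply, map_smul, map_smul, hZ, smul_zero]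
  exact hspan _ (hX.bracket_mem α β)

/-- Testing `J^θ` on each vector of `𝔤` gives continuous real functions, so no topology on the dual
is needed. -/
theorem isClosed_zeroLevel (hη : IsKContactForm η) {Xs : Fin r → VField E M}
    {h : Fin r → M → Fin k → ℝ} (hXs : ∀ α, IsHamiltonian η (Xs α) (h α))
    {𝔤 : Type*} [LieRing 𝔤] [LieAlgebra ℝ 𝔤] (v : Module.Basis (Fin r) ℝ (Module.Dual ℝ 𝔤))
    (θ : Module.Dual ℝ (Fin k → ℝ)) : IsClosed (zeroLevel v h θ) := by
  have heq : zeroLevel v h θ = ⋂ a : 𝔤, {x | momentumMapAlong v h θ x a = 0} := by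
    ext x
    simp [zeroLevel, LinearMap.ext_iff]
  rw [heq]
  refine isClosed_iInter fun a ↦ isClosed_eq (continuous_iff_continuousAt.2 fun x ↦ ?_)
    continuous_const
  exact (hasMFDerivAt_momentumMapAlong hη hXs v θ a x).continuousAt

end Invariance

end KContact

open KContact in
theorem mainTheorem7
    {E : Type*} [NormedAddCommGroup E] [NormedSpace ℝ E] [FiniteDimensional ℝ E]
    {M : Type*} [TopologicalSpace M] [T2Space M] [ChartedSpace E M] [IsManifold 𝓘(ℝ, E) ∞ M]
    {k r : ℕ}
    (η : OneForm E M (Fin k → ℝ)) (hη : IsKContactForm η)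
    (X : ℝ → VField E M) (Xs : Fin r → VField E M) (hX : IsLieSystemWith X Xs)
    (h : Fin r → M → Fin k → ℝ) (hXs : ∀ α, IsHamiltonian η (Xs α) (h α))
    {𝔤 : Type*} [LieRing 𝔤] [LieAlgebra ℝ 𝔤]
    (φ : 𝔤 ≃ₗ[ℝ] Submodule.span ℝ (Set.range h))
    (hφ : ∀ a b : 𝔤, IsBracket η (φ a : M → Fin k → ℝ) (φ b) (φ ⁅a, b⁆))
    (v : Module.Basis (Fin r) ℝ (Module.Dual ℝ 𝔤))
    (θ : Module.Dual ℝ (Fin k → ℝ))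
    (hsub : IsEmbeddedSubmanifold E (zeroLevel v h θ))
    (hreg : ∀ x ∈ zeroLevel v h θ, ∀ w : TangentSpace 𝓘(ℝ, E) x,
      IsTangentAt (zeroLevel v h θ) x w ↔
        ∀ a : 𝔤, mfderiv 𝓘(ℝ, E) 𝓘(ℝ, ℝ) (fun y ↦ momentumMapAlong v h θ y a) x w = 0)
    (htan : ∀ α, ∀ x ∈ zeroLevel v h θ,
      IsTangentAt (zeroLevel v h θ) x (reebDerivation η (h α) x)) :
    IsInvariantUnder X (zeroLevel v h θ) := by
  have : FiniteDimensional ℝ (Submodule.span ℝ (Set.range h)) :=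
    FiniteDimensional.span_of_finite ℝ (Set.finite_range h)
  have : FiniteDimensional ℝ 𝔤 := φ.symm.finiteDimensional
  have hmf : ∀ (a : 𝔤) (x : M) (w : E),
      mfderiv 𝓘(ℝ, E) 𝓘(ℝ, ℝ) (fun y ↦ momentumMapAlong v h θ y a) x w =
        ∑ α, (-v α a) * θ (fderivContraction η (Xs α) x w) := fun a x w ↦ by
    have hsum : (∑ α, (-v α a) • (LinearMap.toContinuousLinearMap θ ∘L
        fderivContraction η (Xs α) x) : E →L[ℝ] ℝ) w =
          ∑ α, (-v α a) * θ (fderivContraction η (Xs α) x w) := by simp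
    exact (congrArg (fun L : E →L[ℝ] ℝ ↦ L w)
      (hasMFDerivAt_momentumMapAlong hη hXs v θ a x).mfderiv).trans hsum
  -- Weak regularity is used in both directions: here vanishing derivatives yield tangency of `Xs
  -- α`, and below tangency of the Reeb derivations yields vanishing derivatives.
  refine isInvariantUnder_of_isTangentAt hX (isClosed_zeroLevel hη hXs v θ) hsub
    fun α x hx ↦ (hreg x hx _).2 fun a ↦ ?_
  refine (hmf a x _).trans (Finset.sum_eq_zero fun β _ ↦ ?_)
  refine mul_eq_zero_of_right _ (fderivContraction_apply_mem_ker hη hX hXs θ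
    ((mem_zeroLevel_iff v h θ).1 hx) (fun β γ ↦ ?_) α β)
  -- Evaluating at the vector dual to `v β` reduces the sum in `hmf` to its `β` term.
  obtain ⟨b, hb⟩ := exists_apply_basis_eq_single v β
  have h1 := (hmf b x _).symm.trans ((hreg x hx _).1 (htan γ x hx) b)
  simp only [hb, neg_mul, ite_mul, one_mul, zero_mul, Finset.sum_neg_distrib, Finset.sum_ite_eq',
    Finset.mem_univ, if_true] at h1
  exact neg_eq_zero.1 h1
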